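/- Let $r,n\ge 1$, let $A=(a_{ij})$ be an $r\times n$ integer matrix, and let $I\subset\mathbb{C}[x_1,\dots,x_n]$ be an ideal generated by monomials (for instance the irrelevant ideal of a fan with $n$ rays). Let $G_A$ denote the torus $(\mathbb{C}^*)^r$ acting on $\mathbb{C}^n$, and on the open subscheme $\mathbb{C}^n-V(I)$, by $$(\lambda_1,\dots,\lambda_r)\cdot x_j=\Big(\prod_{i=1}^r\lambda_i^{a_{ij}}\Big)x_j .$$ A geometric quotient of $U=\mathbb{C}^n-V(I)$ by $G_A$ is a surjective, submersive, $G_A$-invariant morphism $\pi\colon U\to X$ of schemes over $\mathbb{C}$ whose fibres are the orbits (the image of $G_A\times U\to U\times U$, $(g,u)\mapsto(gu,u)$, is $U\times_XU$) and for which $\mathcal{O}_X=(\pi_*\mathcal{O}_U)^{G_A}$. Let $X=(\mathbb{C}^n-V(I))/G_A$ be a geometric quotient. Let $q\neq 1$ be a positive integer such that $q\mid a_{1j}$ for all $j>1$ but $q\nmid a_{11}$. Assume moreover that the columns of $A$ generate $\mathbb{Z}^r$, or that $\gcd(q,a_{11})=1$. Let $B=(b_{ij})$ be the matrix with $b_{i1}=q\,a_{i1}$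 and $b_{ij}=a_{ij}$ for $j>1$. Then a geometric quotient $X_B=(\mathbb{C}^n-V(I))/G_B$ exists, and every such geometric quotient $X_B$ is isomorphic to $X$ as a scheme over $\mathbb{C}$. -/

import Mathlib

open CategoryTheory CategoryTheory.Limits AlgebraicGeometry
open scoped TensorProduct

/-- The base scheme `Spec ℂ`. -/
noncomputable abbrev SpecC : Scheme.{0} := Spec (CommRingCat.of ℂ)

/-- An ideal of `ℂ[x₁, …, xₙ]` generated by monomials. The irrelevant ideal of a fan, generated by
the products of the variables `x_ρ` with `ρ` not a ray of `σ`, for `σ` a cone of the fan, is of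
this form. -/
def IsMonomialIdeal {n : ℕ} (I : Ideal (MvPolynomial (Fin n) ℂ)) : Prop :=
  ∃ S : Set (Fin n →₀ ℕ), I = Ideal.span ((fun s => MvPolynomial.monomial s (1 : ℂ)) '' S)

/-- Affine space `ℂⁿ`. -/
noncomputable abbrev affineSpaceC (n : ℕ) : Scheme.{0} :=
  Spec (CommRingCat.of (MvPolynomial (Fin n) ℂ))

/-- The structure morphism of `ℂⁿ`. -/
noncomputable abbrev affineStr (n : ℕ) : affineSpaceC n ⟶ SpecC :=
  Spec.map (CommRingCat.ofHom (algebraMap ℂ (MvPolynomial (Fin n) ℂ)))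

/-- The open subset `ℂⁿ - V(I)` of `ℂⁿ`. -/
noncomputable def coxOpens {n : ℕ} (I : Ideal (MvPolynomial (Fin n) ℂ)) :
    (affineSpaceC n).Opens :=
  ⟨(PrimeSpectrum.zeroLocus (I : Set (MvPolynomial (Fin n) ℂ)))ᶜ,
    (PrimeSpectrum.isClosed_zeroLocus _).isOpen_compl⟩

/-- The scheme `ℂⁿ - V(I)`. -/
noncomputable abbrev coxSpace {n : ℕ} (I : Ideal (MvPolynomial (Fin n) ℂ)) : Scheme.{0} :=
  (coxOpens I).toScheme

/-- The structure morphism of `ℂⁿ - V(I)`. -/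
noncomputable abbrev coxStr {n : ℕ} (I : Ideal (MvPolynomial (Fin n) ℂ)) :
    coxSpace I ⟶ SpecC :=
  (coxOpens I).ι ≫ affineStr n

/-- The ring `ℂ[ℤʳ]` of Laurent polynomials in `λ₁, …, λᵣ`. -/
abbrev LaurentRing (r : ℕ) : Type := AddMonoidAlgebra ℂ (Fin r → ℤ)

/-- The Laurent monomial `∏ᵢ λᵢ ^ mᵢ`. -/
noncomputable def laurentMonomial {r : ℕ} (m : Fin r → ℤ) : LaurentRing r :=
  AddMonoidAlgebra.single m 1

/-- The torus `G = (ℂ^*)ʳ`. -/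
noncomputable abbrev torusC (r : ℕ) : Scheme.{0} :=
  Spec (CommRingCat.of (LaurentRing r))

/-- The structure morphism of the torus. -/
noncomputable abbrev torusStr (r : ℕ) : torusC r ⟶ SpecC :=
  Spec.map (CommRingCat.ofHom (algebraMap ℂ (LaurentRing r)))

/-- The coaction of the torus with weight matrix `A`, with `x_j ↦ (∏ᵢ λᵢ ^ a_{ij}) x_j`. -/
noncomputable def coaction {r n : ℕ} (A : Matrix (Fin r) (Fin n) ℤ) :
    MvPolynomial (Fin n) ℂ →ₐ[ℂ] LaurentRing r ⊗[ℂ] MvPolynomial (Fin n) ℂ :=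
  MvPolynomial.aeval fun j => laurentMonomial (fun i => A i j) ⊗ₜ[ℂ] MvPolynomial.X j

/-- The action `G × ℂⁿ ⟶ ℂⁿ` of the torus with weight matrix `A`. -/
noncomputable def affineAction {r n : ℕ} (A : Matrix (Fin r) (Fin n) ℤ) :
    pullback (torusStr r) (affineStr n) ⟶ affineSpaceC n :=
  (pullbackSpecIso ℂ (LaurentRing r) (MvPolynomial (Fin n) ℂ)).hom ≫
    Spec.map (CommRingCat.ofHom (coaction A).toRingHom)

/-- The inclusion `G × (ℂⁿ - V(I)) ⟶ G × ℂⁿ`. -/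
noncomputable def torusProdIncl (r : ℕ) {n : ℕ} (I : Ideal (MvPolynomial (Fin n) ℂ)) :
    pullback (torusStr r) (coxStr I) ⟶ pullback (torusStr r) (affineStr n) :=
  pullback.map _ _ _ _ (𝟙 _) (coxOpens I).ι (𝟙 _) (by simp) (by simp)

/-- A Laurent monomial is a unit. -/
theorem isUnit_laurentMonomial {r : ℕ} (m : Fin r → ℤ) : IsUnit (laurentMonomial m) := by
  refine IsUnit.of_mul_eq_one (laurentMonomial (-m)) ?_
  simp [laurentMonomial, AddMonoidAlgebra.single_mul_single, AddMonoidAlgebra.one_def]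

/-- The coaction multiplies each monomial by a unit. -/
theorem coaction_monomial {r n : ℕ} (A : Matrix (Fin r) (Fin n) ℤ) (s : Fin n →₀ ℕ) :
    ∃ u : LaurentRing r, IsUnit u ∧
      coaction A (MvPolynomial.monomial s 1) = u ⊗ₜ[ℂ] MvPolynomial.monomial s (1 : ℂ) := by
  induction s using Finsupp.induction_linear with
  | zero => exact ⟨1, isUnit_one, map_one _⟩
  | add s t hs ht =>
    obtain ⟨u, hu, h1⟩ := hs
    obtain ⟨v, hv, h2⟩ := ht
    refine ⟨u * v, hu.mul hv, ?_⟩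
    have h : MvPolynomial.monomial (s + t) (1 : ℂ)
        = MvPolynomial.monomial s 1 * MvPolynomial.monomial t 1 := by
      simp [MvPolynomial.monomial_mul]
    rw [h, map_mul, h1, h2, Algebra.TensorProduct.tmul_mul_tmul]
  | single j k =>
    refine ⟨laurentMonomial (fun i => A i j) ^ k, (isUnit_laurentMonomial _).pow k, ?_⟩
    rw [← MvPolynomial.X_pow_eq_monomial, map_pow]
    simp [coaction, Algebra.TensorProduct.tmul_pow]

/-- The torus action preserves `ℂⁿ - V(I)` for a monomial ideal `I`. -/
theorem range_torusProdIncl_affineAction {r n : ℕ} (A : Matrix (Fin r) (Fin n) ℤ)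
    {I : Ideal (MvPolynomial (Fin n) ℂ)} (hI : IsMonomialIdeal I) :
    Set.range (torusProdIncl r I ≫ affineAction A) ⊆ Set.range (coxOpens I).ι := by
  rintro _ ⟨p, rfl⟩
  rw [Scheme.Opens.range_ι]
  have hsnd : (torusProdIncl r I ≫
      (pullbackSpecIso ℂ (LaurentRing r) (MvPolynomial (Fin n) ℂ)).hom) ≫
      Spec.map (CommRingCat.ofHom
        (Algebra.TensorProduct.includeRight : MvPolynomial (Fin n) ℂ →ₐ[ℂ]
          LaurentRing r ⊗[ℂ] MvPolynomial (Fin n) ℂ).toRingHom) =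
      pullback.snd (torusStr r) (coxStr I) ≫ (coxOpens I).ι := by
    rw [Category.assoc]
    erw [pullbackSpecIso_hom_snd]
    exact pullback.lift_snd _ _ _
  set y := (torusProdIncl r I ≫
      (pullbackSpecIso ℂ (LaurentRing r) (MvPolynomial (Fin n) ℂ)).hom) p with hy
  have h1 : Spec.map (CommRingCat.ofHom
        (Algebra.TensorProduct.includeRight : MvPolynomial (Fin n) ℂ →ₐ[ℂ]
          LaurentRing r ⊗[ℂ] MvPolynomial (Fin n) ℂ).toRingHom) y ∈ coxOpens I := by
    rw [hy, ← Scheme.Hom.comp_apply, hsnd, Scheme.Hom.comp_apply]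
    exact ((pullback.snd (torusStr r) (coxStr I)) p).2
  have h2 : (torusProdIncl r I ≫ affineAction A) p =
      Spec.map (CommRingCat.ofHom (coaction A).toRingHom) y := by
    rw [hy, ← Scheme.Hom.comp_apply, Category.assoc]
    rfl
  rw [h2]
  intro h3
  apply h1
  obtain ⟨S, rfl⟩ := hI
  have h4 : ∀ z : PrimeSpectrum (MvPolynomial (Fin n) ℂ),
      z ∈ PrimeSpectrum.zeroLocus ((Ideal.span ((fun s => MvPolynomial.monomial s (1 : ℂ)) '' S) :
        Ideal (MvPolynomial (Fin n) ℂ)) : Set (MvPolynomial (Fin n) ℂ)) ↔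
      ∀ s ∈ S, MvPolynomial.monomial s (1 : ℂ) ∈ z.asIdeal := by
    intro z
    rw [PrimeSpectrum.zeroLocus_span, PrimeSpectrum.mem_zeroLocus, Set.image_subset_iff]
    rfl
  refine (h4 _).2 fun s hs => ?_
  have h5 := (h4 _).1 h3 s hs
  obtain ⟨u, hu, hus⟩ := coaction_monomial A s
  have h6 : coaction A (MvPolynomial.monomial s 1) ∈ y.asIdeal := h5
  change (1 : LaurentRing r) ⊗ₜ[ℂ] MvPolynomial.monomial s (1 : ℂ) ∈ y.asIdeal
  obtain ⟨v, hv⟩ := hu.exists_left_inv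
  have h7 := y.asIdeal.mul_mem_left (v ⊗ₜ[ℂ] (1 : MvPolynomial (Fin n) ℂ)) h6
  rwa [hus, Algebra.TensorProduct.tmul_mul_tmul, hv, one_mul] at h7

/-- The action `G × (ℂⁿ - V(I)) ⟶ ℂⁿ - V(I)` of the torus with weight matrix `A`: the restriction
of its action on `ℂⁿ`. -/
noncomputable def coxAction {r n : ℕ} (A : Matrix (Fin r) (Fin n) ℤ)
    {I : Ideal (MvPolynomial (Fin n) ℂ)} (hI : IsMonomialIdeal I) :
    pullback (torusStr r) (coxStr I) ⟶ coxSpace I :=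
  IsOpenImmersion.lift (coxOpens I).ι (torusProdIncl r I ≫ affineAction A)
    (range_torusProdIncl_affineAction A hI)

/-- Geometric quotients, in the sense of Mumford, for an action `act : P = G × U ⟶ U` with
second projection `pr : P ⟶ U`. -/
structure IsGeometricQuotient {P U X : Scheme.{0}} (act pr : P ⟶ U) (π : U ⟶ X) : Prop where
  /-- `π` is invariant. -/
  invariant : act ≫ π = pr ≫ π
  /-- `π` is surjective. -/
  surjective : Function.Surjective π
  /-- The fibres of `π` are the orbits: the image of `(act, pr)` is `U ×_X U`. -/
  orbits : Function.Surjective (pullback.lift act pr invariant : P ⟶ pullback π π)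
  /-- `π` is submersive. -/
  submersive : ∀ V : Set X, IsOpen V ↔ IsOpen (π ⁻¹' V)
  /-- `𝒪_X ⟶ π_* 𝒪_U` is injective. -/
  injective : ∀ V : X.Opens, Function.Injective (π.app V)
  /-- The image of `𝒪_X ⟶ π_* 𝒪_U` consists of the invariant functions. -/
  range_app : ∀ (V : X.Opens) (f : Γ(U, π ⁻¹ᵁ V)),
    f ∈ Set.range (π.app V) ↔
      act.appLE (π ⁻¹ᵁ V) ((pr ≫ π) ⁻¹ᵁ V) (by rw [← invariant]; rfl) f =
        pr.appLE (π ⁻¹ᵁ V) ((pr ≫ π) ⁻¹ᵁ V) le_rfl f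

/-- The morphism `π : ℂⁿ - V(I) ⟶ X` is a morphism over `ℂ` (where `x` is the structure morphism of
`X`) and a geometric quotient by the torus `(ℂ^*)ʳ` acting
with weight matrix `A`, so that `X = (ℂⁿ - V(I)) / G_A`. -/
def IsCoxQuotient {r n : ℕ} (A : Matrix (Fin r) (Fin n) ℤ)
    {I : Ideal (MvPolynomial (Fin n) ℂ)} (hI : IsMonomialIdeal I)
    {X : Scheme.{0}} (x : X ⟶ SpecC) (π : coxSpace I ⟶ X) : Prop :=
  π ≫ x = coxStr I ∧
    IsGeometricQuotient (coxAction A hI) (pullback.snd (torusStr r) (coxStr I)) π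

/-- The matrix obtained from `A` by multiplying its first column by `q`. -/
def mulFirstCol {r n : ℕ} [NeZero n] (A : Matrix (Fin r) (Fin n) ℤ) (q : ℕ) :
    Matrix (Fin r) (Fin n) ℤ :=
  Matrix.of fun i j => if j = 0 then (q : ℤ) * A i j else A i j

/-! Write U = ℂⁿ - V(I) and let φ be the map x₁ ↦ x₁ ^ q. Since I is monomial, V(I) depends only on
which coordinates vanish, so φ restricts to a surjective integral map U ⟶ U. It is equivariant, with
the identity on the torus, from the action of weight A to that of weight B, because (λ^a x₁)^q =
λ^(qa) x₁^q. It is also the quotient of U by the q-th roots of unity scaling x₁.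

These scalings already come from G_A. If z is a primitive q-th root of unity, the torus point (z, 1,
…, 1) multiplies x₁ by z^a₁₁ and fixes the other coordinates, as q divides their weights
(`torusPoint_coxAction`). Coprimality of q and a₁₁ makes z^a₁₁ primitive again; if the columns of A
generate ℤʳ, coprimality follows by reading the first row modulo q.

Hence π is invariant under all these scalings and factors as φ followed by some ρ : U ⟶ X
(`exists_desc_coxPow`). All properties of a geometric quotient pass from π to ρ
(`IsGeometricQuotient.of_comp`), so X itself is a quotient by G_B. A geometric quotient is
categorical, hence unique up to isomorphism (`exists_iso_of_isGeometricQuotient`). Both the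
factorization and the uniqueness rest on `exists_desc`. -/

/-! ### Descent of morphisms and sections along topological quotient maps. -/

theorem appLE_congr_hom {X Y : Scheme.{0}} {f g : X ⟶ Y} (h : f = g) (V : Y.Opens) (W : X.Opens)
    (e : W ≤ f ⁻¹ᵁ V) : f.appLE V W e = g.appLE V W (h ▸ e) := by
  subst h
  rfl

/-- A surjective morphism of schemes that is injective on sections is an epimorphism. -/
theorem epi_of_surjective_of_app_injective {U Y : Scheme.{0}} (p : U ⟶ Y)
    (hp : Function.Surjective p) (hinj : ∀ W : Y.Opens, Function.Injective (p.app W)) : Epi p := by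
  refine ⟨fun {Z} a b h => ?_⟩
  have hbase : a.base = b.base := by
    ext y
    obtain ⟨u, rfl⟩ := hp y
    exact congr($h u)
  refine Scheme.Hom.ext hbase fun V => ?_
  ext s
  apply hinj
  rw [← CommRingCat.comp_apply, ← CommRingCat.comp_apply, Category.assoc,
    Scheme.Hom.app_eq_appLE, Scheme.Hom.app_eq_appLE, Scheme.Hom.app_eq_appLE]
  have h2 := appLE_congr_hom h V (p ⁻¹ᵁ (b ⁻¹ᵁ V)) (h ▸ le_rfl)
  rw [Scheme.Hom.map_appLE, Scheme.Hom.appLE_comp_appLE, Scheme.Hom.appLE_comp_appLE, h2]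

/-- Descent of a morphism along a topological quotient map of schemes that is injective on
sections. -/
theorem exists_desc {U Y Z : Scheme.{0}} (p : U ⟶ Y) (ψ : U ⟶ Z)
    (hp : Topology.IsQuotientMap p) (hinj : ∀ W : Y.Opens, Function.Injective (p.app W))
    (hfib : ∀ u v, p u = p v → ψ u = ψ v)
    (hsec : ∀ (W : Y.Opens) (V : Z.Opens) (e : p ⁻¹ᵁ W ≤ ψ ⁻¹ᵁ V) (s : Γ(Z, V)),
      ψ.appLE V (p ⁻¹ᵁ W) e s ∈ Set.range (p.app W)) :
    ∃ χ : Y ⟶ Z, p ≫ χ = ψ := by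
  let c : C(Y, Z) := Topology.IsQuotientMap.lift (f := p.base.hom) hp ψ.base.hom hfib
  have hc : ∀ u, c (p u) = ψ u := fun u =>
    congr($(Topology.IsQuotientMap.lift_comp (f := p.base.hom) hp ψ.base.hom hfib) u)
  let W (V : Z.Opens) : Y.Opens := (TopologicalSpace.Opens.map (TopCat.ofHom c)).obj V
  have e (V : Z.Opens) : p ⁻¹ᵁ W V ≤ ψ ⁻¹ᵁ V := fun u hu => by
    have : c (p u) ∈ V := hu
    rwa [hc] at this
  have hex (V : Z.Opens) : ∃ g : Γ(Z, V) ⟶ Γ(Y, W V),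
      g ≫ p.app (W V) = ψ.appLE V (p ⁻¹ᵁ W V) (e V) := by
    -- Injectivity identifies sections over `W V` with their image upstairs, and `hsec` puts the
    -- pullback of every section of Z in that image.
    have hbij : Function.Bijective (p.app (W V)).hom.rangeRestrict :=
      ⟨fun a b h => hinj _ (congrArg Subtype.val h), RingHom.rangeRestrict_surjective _⟩
    refine ⟨CommRingCat.ofHom (((RingEquiv.ofBijective _ hbij).symm :
        (p.app (W V)).hom.range →+* Γ(Y, W V)).comp
      ((ψ.appLE V (p ⁻¹ᵁ W V) (e V)).hom.codRestrict (p.app (W V)).hom.range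
        fun s => hsec _ _ (e V) s)), ?_⟩
    ext s
    exact congrArg Subtype.val (RingEquiv.apply_symm_apply (RingEquiv.ofBijective _ hbij)
      ((ψ.appLE V (p ⁻¹ᵁ W V) (e V)).hom.codRestrict (p.app (W V)).hom.range
        (fun s => hsec _ _ (e V) s) s))
  choose g hg using hex
  have hnat (V V' : Z.Opens) (i : V' ≤ V) : Z.presheaf.map (homOfLE i).op ≫ g V' =
      g V ≫ Y.presheaf.map (homOfLE (show W V' ≤ W V from fun _ h => i h)).op := by
    ext s
    apply hinj
    simp only [← CommRingCat.comp_apply, Category.assoc, hg]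
    rw [Scheme.Hom.naturality, reassoc_of% (hg V), Scheme.Hom.map_appLE, Scheme.Hom.appLE_map]
  let χ₀ : Y.toPresheafedSpace ⟶ Z.toPresheafedSpace :=
    { base := TopCat.ofHom c
      c := { app := fun V => g V.unop
             naturality := fun V V' i => hnat V.unop V'.unop i.unop.le } }
  have hχ₀ : p.toPshHom ≫ χ₀ = ψ.toPshHom := by
    refine PresheafedSpace.Hom.ext _ _ (by ext u; exact hc u) ?_
    refine TopCat.Presheaf.ext fun V => ?_
    have : (g V ≫ p.app (W V)) ≫ U.presheaf.map (eqToHom (by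
        ext u
        change ψ u ∈ V ↔ c (p u) ∈ V
        rw [hc])).op
      = ψ.app V := by
      rw [hg, Scheme.Hom.appLE_map, Scheme.Hom.app_eq_appLE]
    exact Eq.trans (congrArg (fun i => (g V ≫ p.app (W V)) ≫ U.presheaf.map i)
      (Subsingleton.elim _ _)) this
  -- Stated for any map equal to `ψ`, so that it applies to the composite of `p` and `χ₀`. A ring
  -- map is local if its composite with a further map is, so `χ₀` is local at every point of the
  -- form `p u`.
  have hloc : ∀ (α : U.toPresheafedSpace ⟶ Z.toPresheafedSpace) (u : U), α = ψ.toPshHom →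
      IsLocalHom (α.stalkMap u).hom := by
    rintro _ u rfl
    exact inferInstanceAs (IsLocalHom (ψ.stalkMap u).hom)
  let χ : Y ⟶ Z := ⟨⟨χ₀, by
    intro y
    obtain ⟨u, rfl⟩ := hp.surjective y
    have h1 := hloc _ u hχ₀
    rw [PresheafedSpace.stalkMap.comp] at h1
    exact @isLocalHom_of_comp _ _ _ _ _ _ (χ₀.stalkMap (p u)).hom (p.toPshHom.stalkMap u).hom h1⟩⟩
  exact ⟨χ, Scheme.Hom.ext' (LocallyRingedSpace.Hom.ext' hχ₀)⟩

/-- Whether a section lies in the image of the sections of the target is a local question. -/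
theorem mem_range_app_of_local {U Y : Scheme.{0}} (p : U ⟶ Y)
    (hinj : ∀ W : Y.Opens, Function.Injective (p.app W)) (W : Y.Opens) (s : Γ(U, p ⁻¹ᵁ W))
    (h : ∀ y ∈ W, ∃ (W' : Y.Opens) (i : W' ≤ W), y ∈ W' ∧
      U.presheaf.map (homOfLE (p.preimage_mono i)).op s ∈ Set.range (p.app W')) :
    s ∈ Set.range (p.app W) := by
  have h' : ∀ y : W, ∃ (W' : Y.Opens) (i : W' ≤ W) (t : Γ(Y, W')), y.1 ∈ W' ∧
      p.app W' t = U.presheaf.map (homOfLE (p.preimage_mono i)).op s := fun y => by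
    obtain ⟨W', i, hy, t, ht⟩ := h y y.2
    exact ⟨W', i, t, hy, ht⟩
  choose W' i t hy ht using h'
  have hcov : W ≤ iSup W' := fun y hyW => TopologicalSpace.Opens.mem_iSup.2 ⟨⟨y, hyW⟩, hy ⟨y, hyW⟩⟩
  -- By injectivity, agreement on overlaps can be tested on U, where every local piece is a
  -- restriction of `s`.
  have hglue : ∃ g : Γ(Y, W), ∀ y, Y.presheaf.map (homOfLE (i y)).op g = t y := by
    obtain ⟨g, hg, -⟩ := Y.sheaf.existsUnique_gluing' W' W (fun y => homOfLE (i y)) hcov t (by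
      intro y z
      apply hinj
      change (p.app (W' y ⊓ W' z)) (Y.presheaf.map _ _) = (p.app (W' y ⊓ W' z)) (Y.presheaf.map _ _)
      rw [← CommRingCat.comp_apply, ← CommRingCat.comp_apply, Scheme.Hom.naturality,
        Scheme.Hom.naturality, CommRingCat.comp_apply, CommRingCat.comp_apply, ht, ht,
        ← CommRingCat.comp_apply, ← CommRingCat.comp_apply, ← Functor.map_comp, ← Functor.map_comp]
      rfl)
    exact ⟨g, hg⟩
  obtain ⟨g, hg⟩ := hglue
  refine ⟨g, U.sheaf.eq_of_locally_eq' (fun y => p ⁻¹ᵁ W' y) (p ⁻¹ᵁ W)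
    (fun y => homOfLE (p.preimage_mono (i y))) ?_ _ _ fun y => ?_⟩
  · rw [← Scheme.Hom.preimage_iSup]
    exact p.preimage_mono hcov
  · change U.presheaf.map (homOfLE (p.preimage_mono (i y))).op (p.app W g) =
      U.presheaf.map (homOfLE (p.preimage_mono (i y))).op s
    rw [← ht y, ← hg y, ← CommRingCat.comp_apply, ← CommRingCat.comp_apply,
      Scheme.Hom.naturality]
    rfl

/-! ### Formal properties of geometric quotients. -/

theorem appLE_appLE_apply {X Y Y' Z : Scheme.{0}} {f : X ⟶ Y} {g : Y ⟶ Z} {f' : X ⟶ Y'}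
    {g' : Y' ⟶ Z} (h : f ≫ g = f' ≫ g') {W : X.Opens} {V : Y.Opens} {V' : Y'.Opens} {O : Z.Opens}
    (e₁ : W ≤ f ⁻¹ᵁ V) (e₂ : V ≤ g ⁻¹ᵁ O) (e₁' : W ≤ f' ⁻¹ᵁ V') (e₂' : V' ≤ g' ⁻¹ᵁ O)
    (s : Γ(Z, O)) :
    f.appLE V W e₁ (g.appLE O V e₂ s) = f'.appLE V' W e₁' (g'.appLE O V' e₂' s) := by
  rw [← CommRingCat.comp_apply, ← CommRingCat.comp_apply, Scheme.Hom.appLE_comp_appLE,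
    Scheme.Hom.appLE_comp_appLE, appLE_congr_hom h]

theorem isQuotientMap_of_isGeometricQuotient {P U X : Scheme.{0}} {act pr : P ⟶ U} {π : U ⟶ X}
    (hπ : IsGeometricQuotient act pr π) : Topology.IsQuotientMap π :=
  (Topology.isQuotientMap_iff _).2
    ⟨Topology.isCoinducing_iff.2 fun V => (hπ.submersive V).symm, hπ.surjective⟩

theorem epi_of_isGeometricQuotient {P U X : Scheme.{0}} {act pr : P ⟶ U} {π : U ⟶ X}
    (hπ : IsGeometricQuotient act pr π) : Epi π :=
  epi_of_surjective_of_app_injective π hπ.surjective hπ.injective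

/-- A geometric quotient is a categorical quotient. -/
theorem exists_desc_of_isGeometricQuotient {P U X Z : Scheme.{0}} {act pr : P ⟶ U} {π : U ⟶ X}
    (hπ : IsGeometricQuotient act pr π) (ψ : U ⟶ Z) (hψ : act ≫ ψ = pr ≫ ψ) :
    ∃ χ : X ⟶ Z, π ≫ χ = ψ := by
  refine exists_desc π ψ (isQuotientMap_of_isGeometricQuotient hπ) hπ.injective ?_ ?_
  · intro u v huv
    obtain ⟨z, rfl, rfl⟩ := Scheme.Pullback.exists_preimage_pullback u v huv
    obtain ⟨p, rfl⟩ := hπ.orbits z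
    have h1 := congr($hψ p)
    have h2 := congr($(pullback.lift_fst act pr hπ.invariant) p)
    have h3 := congr($(pullback.lift_snd act pr hπ.invariant) p)
    rw [Scheme.Hom.comp_apply] at h1 h2 h3
    rw [h2, h3]
    exact h1
  · intro W V e s
    rw [hπ.range_app]
    exact appLE_appLE_apply hψ _ e _ e s

/-- Geometric quotients are unique. -/
theorem exists_iso_of_isGeometricQuotient {P U X Y : Scheme.{0}} {act pr : P ⟶ U} {π : U ⟶ X}
    {ρ : U ⟶ Y} (hπ : IsGeometricQuotient act pr π) (hρ : IsGeometricQuotient act pr ρ) :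
    ∃ e : Y ≅ X, ρ ≫ e.hom = π := by
  obtain ⟨a, ha⟩ := exists_desc_of_isGeometricQuotient hρ π hπ.invariant
  obtain ⟨b, hb⟩ := exists_desc_of_isGeometricQuotient hπ ρ hρ.invariant
  have := epi_of_isGeometricQuotient hπ
  have := epi_of_isGeometricQuotient hρ
  exact ⟨⟨a, b, by rw [← cancel_epi ρ, reassoc_of% ha, hb, Category.comp_id],
    by rw [← cancel_epi π, reassoc_of% hb, ha, Category.comp_id]⟩, ha⟩

/-- If a geometric quotient factors through an equivariant surjection `φ : U ⟶ U'` that is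
injective on sections, then the second factor is a geometric quotient of `U'`. -/
theorem IsGeometricQuotient.of_comp {P U P' U' X : Scheme.{0}} {act pr : P ⟶ U}
    {act' pr' : P' ⟶ U'} {φ : U ⟶ U'} {Φ : P ⟶ P'} {ρ : U' ⟶ X}
    (h : IsGeometricQuotient act pr (φ ≫ ρ)) (hact : Φ ≫ act' = act ≫ φ) (hpr : Φ ≫ pr' = pr ≫ φ)
    (hφ : Function.Surjective φ) (hΦ : Epi Φ)
    (hφi : ∀ W : U'.Opens, Function.Injective (φ.app W)) :
    IsGeometricQuotient act' pr' ρ := by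
  have hinv : act' ≫ ρ = pr' ≫ ρ := by
    rw [← cancel_epi Φ, reassoc_of% hact, reassoc_of% hpr]
    exact h.invariant
  have happ (V : X.Opens) (s) : (φ ≫ ρ).app V s = φ.app (ρ ⁻¹ᵁ V) (ρ.app V s) := by
    rw [Scheme.Hom.comp_app]
    rfl
  refine ⟨hinv, ?_, ?_, ?_, ?_, ?_⟩
  · exact Function.Surjective.of_comp (g := φ) (by simpa using h.surjective)
  · have : Surjective φ := ⟨hφ⟩
    -- U ×_X U surjects onto U' ×_X U', which carries the orbit condition down.
    let m : pullback (φ ≫ ρ) (φ ≫ ρ) ⟶ pullback ρ ρ :=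
      pullback.map _ _ _ _ φ φ (𝟙 X) (by simp) (by simp)
    have hm : Function.Surjective m := by
      intro z
      have : z ∈ Set.range m := by
        rw [Scheme.Pullback.range_map]
        exact ⟨hφ _, hφ _⟩
      exact this
    have heq : Φ ≫ pullback.lift act' pr' hinv = pullback.lift act pr h.invariant ≫ m := by
      apply pullback.hom_ext
      · rw [Category.assoc, Category.assoc, pullback.lift_fst, pullback.lift_fst,
          pullback.lift_fst_assoc, hact]
      · rw [Category.assoc, Category.assoc, pullback.lift_snd, pullback.lift_snd,
          pullback.lift_snd_assoc, hpr]
    intro z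
    obtain ⟨p, hp⟩ := (hm.comp h.orbits) z
    exact ⟨Φ p, by simpa [← hp] using congr($heq p)⟩
  · intro V
    exact ⟨fun hV => hV.preimage ρ.continuous,
      fun hV => (h.submersive V).2 (hV.preimage φ.continuous)⟩
  · intro V s t hst
    exact h.injective V (by rw [happ, happ, hst])
  · intro V f
    constructor
    · rintro ⟨s, rfl⟩
      rw [Scheme.Hom.app_eq_appLE]
      exact appLE_appLE_apply hinv _ _ _ _ s
    · intro hf
      have e : (pr ≫ φ ≫ ρ) ⁻¹ᵁ V ≤ Φ ⁻¹ᵁ ((pr' ≫ ρ) ⁻¹ᵁ V) := by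
        rw [← Scheme.Hom.comp_preimage, reassoc_of% hpr]
      -- Pulling the invariance of `f` back along Φ shows that its pullback by `φ` is invariant on
      -- U, hence comes from X.
      obtain ⟨s, hs⟩ := (h.range_app V (φ.app (ρ ⁻¹ᵁ V) f)).2 (by
        rw [Scheme.Hom.app_eq_appLE]
        refine (appLE_appLE_apply hact.symm _ _ e _ f).trans
          ((congrArg (Φ.appLE _ _ e) hf).trans (appLE_appLE_apply hpr _ _ _ _ f)))
      exact ⟨s, hφi _ (by rw [← happ, hs])⟩

/-! ### Polynomial algebra: the power substitution and its invariance group. -/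

/-- The substitution `x₁ ↦ x₁ ^ q`. -/
noncomputable def powFirst (n : ℕ) [NeZero n] (q : ℕ) :
    MvPolynomial (Fin n) ℂ →ₐ[ℂ] MvPolynomial (Fin n) ℂ :=
  MvPolynomial.aeval fun j => if j = 0 then MvPolynomial.X j ^ q else MvPolynomial.X j

/-- The substitution `x₁ ↦ w x₁`. -/
noncomputable def scaleFirst (n : ℕ) [NeZero n] (w : ℂ) :
    MvPolynomial (Fin n) ℂ →ₐ[ℂ] MvPolynomial (Fin n) ℂ :=
  MvPolynomial.aeval fun j =>
    if j = 0 then MvPolynomial.C w * MvPolynomial.X j else MvPolynomial.X j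

section Substitutions

variable {n : ℕ} [NeZero n]

@[simp] theorem powFirst_X (q : ℕ) (j : Fin n) : powFirst n q (MvPolynomial.X j) =
    if j = 0 then MvPolynomial.X j ^ q else MvPolynomial.X j := by
  simp [powFirst]

@[simp] theorem scaleFirst_X (w : ℂ) (j : Fin n) : scaleFirst n w (MvPolynomial.X j) =
    if j = 0 then MvPolynomial.C w * MvPolynomial.X j else MvPolynomial.X j := by
  simp [scaleFirst]

@[simp] theorem scaleFirst_C (w a : ℂ) :
    scaleFirst n w (MvPolynomial.C a) = MvPolynomial.C a :=
  (scaleFirst n w).commutes a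

theorem scaleFirst_comp (v w : ℂ) :
    (scaleFirst n v).comp (scaleFirst n w) = scaleFirst n (v * w) := by
  refine MvPolynomial.algHom_ext fun j => ?_
  rcases eq_or_ne j 0 with rfl | hj
  · simp [mul_left_comm, mul_assoc]
  · simp [hj]

theorem scaleFirst_one : scaleFirst n 1 = AlgHom.id ℂ _ := by
  refine MvPolynomial.algHom_ext fun j => ?_
  rcases eq_or_ne j 0 with rfl | hj
  · simp
  · simp [hj]

theorem scaleFirst_comp_powFirst {w : ℂ} {q : ℕ} (hw : w ^ q = 1) :
    (scaleFirst n w).comp (powFirst n q) = powFirst n q := by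
  refine MvPolynomial.algHom_ext fun j => ?_
  rcases eq_or_ne j 0 with rfl | hj
  · have : (MvPolynomial.C w : MvPolynomial (Fin n) ℂ) ^ q = 1 := by rw [← map_pow, hw, map_one]
    simp [mul_pow, this]
  · simp [hj]

/-- Raising the remaining variables to the q-th power afterwards gives `MvPolynomial.expand q`,
which is injective. -/
theorem powFirst_injective {q : ℕ} (hq : 0 < q) : Function.Injective (powFirst n q) := by
  let ψ : MvPolynomial (Fin n) ℂ →ₐ[ℂ] MvPolynomial (Fin n) ℂ :=
    MvPolynomial.aeval fun j => if j = 0 then MvPolynomial.X j else MvPolynomial.X j ^ q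
  have h : ψ.comp (powFirst n q) = MvPolynomial.expand q := by
    refine MvPolynomial.algHom_ext fun j => ?_
    rcases eq_or_ne j 0 with rfl | hj
    · simp [ψ]
    · simp [ψ, hj]
  refine Function.Injective.of_comp (f := ψ) ?_
  rw [← AlgHom.coe_comp, h]
  exact MvPolynomial.expand_injective hq

theorem powFirst_isIntegral {q : ℕ} (hq : 0 < q) : (powFirst n q).toRingHom.IsIntegral := by
  intro f
  induction f using MvPolynomial.induction_on with
  | C a =>
    have := (powFirst n q).toRingHom.isIntegralElem_map (x := MvPolynomial.C a)
    simpa [← MvPolynomial.algebraMap_eq] using this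
  | add f g hf hg => exact hf.add _ hg
  | mul_X f j hf =>
    refine hf.mul _ ?_
    rcases eq_or_ne j 0 with rfl | hj
    · exact ⟨Polynomial.X ^ q - Polynomial.C (MvPolynomial.X 0),
        Polynomial.monic_X_pow_sub_C _ hq.ne', by simp⟩
    · have := (powFirst n q).toRingHom.isIntegralElem_map (x := MvPolynomial.X j)
      simpa [hj] using this

theorem coeff_scaleFirst (w : ℂ) (f : MvPolynomial (Fin n) ℂ) (s : Fin n →₀ ℕ) :
    (scaleFirst n w f).coeff s = w ^ s 0 * f.coeff s := by
  classical
  induction f using MvPolynomial.induction_on' with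
  | monomial t a =>
    have : scaleFirst n w (MvPolynomial.monomial t a) = MvPolynomial.monomial t (w ^ t 0 * a) := by
      have h0 : ∀ j : Fin n, (if j = 0 then MvPolynomial.C w * MvPolynomial.X j
          else (MvPolynomial.X j : MvPolynomial (Fin n) ℂ)) ^ t j =
          (if j = 0 then MvPolynomial.C w ^ t j else 1) * MvPolynomial.X j ^ t j := by
        intro j
        split_ifs <;> simp [mul_pow]
      rw [scaleFirst, MvPolynomial.aeval_monomial, Finsupp.prod_fintype _ _ (by simp),
        MvPolynomial.monomial_eq, Finsupp.prod_fintype _ _ (by simp)]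
      simp only [h0, Finset.prod_mul_distrib, Finset.prod_ite_eq', Finset.mem_univ, if_true,
        MvPolynomial.algebraMap_eq, map_mul, map_pow]
      ring
    rw [this, MvPolynomial.coeff_monomial, MvPolynomial.coeff_monomial]
    split_ifs with h
    · rw [h]
    · simp
  | add f g hf hg => simp [hf, hg, mul_add]

/-- Scaling is diagonal on monomials with eigenvalue w^(s 0), so a fixed polynomial only involves
exponents of x₁ divisible by q. -/
theorem mem_range_powFirst {w : ℂ} {q : ℕ} (hw : IsPrimitiveRoot w q)
    {f : MvPolynomial (Fin n) ℂ} (hf : scaleFirst n w f = f) : f ∈ (powFirst n q).range := by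
  rw [f.as_sum]
  refine Subalgebra.sum_mem _ fun s hs => ?_
  have hdvd : q ∣ s 0 := by
    have h := coeff_scaleFirst w f s
    rw [hf] at h
    rw [← hw.pow_eq_one_iff_dvd]
    exact mul_right_cancel₀ (MvPolynomial.mem_support_iff.1 hs) (by rw [← h, one_mul])
  rw [MvPolynomial.monomial_eq]
  refine Subalgebra.mul_mem _ (Subalgebra.algebraMap_mem _ _) (Subalgebra.prod_mem _ fun j _ => ?_)
  rcases eq_or_ne j 0 with rfl | hj
  · obtain ⟨k, hk⟩ := hdvd
    exact ⟨MvPolynomial.X 0 ^ k, by simp [hk, pow_mul]⟩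
  · exact ⟨MvPolynomial.X j ^ s j, by simp [hj]⟩

/-- Two primes with the same contraction along `x₁ ↦ x₁ ^ q` differ by a scaling of `x₁` by a
root of unity. -/
theorem exists_comap_scaleFirst_eq {w : ℂ} {q : ℕ} (hq : 0 < q) (hw : IsPrimitiveRoot w q)
    (P Q : Ideal (MvPolynomial (Fin n) ℂ)) [P.IsPrime] [Q.IsPrime]
    (hPQ : P.comap (powFirst n q) = Q.comap (powFirst n q)) :
    ∃ k : ℕ, P = Q.comap (scaleFirst n (w ^ k)) := by
  have hw0 : w ≠ 0 := hw.ne_zero hq.ne'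
  let σ : MvPolynomial (Fin n) ℂ ≃ₐ[ℂ] MvPolynomial (Fin n) ℂ :=
    AlgEquiv.ofAlgHom (scaleFirst n w) (scaleFirst n w⁻¹)
      (by rw [scaleFirst_comp, mul_inv_cancel₀ hw0, scaleFirst_one])
      (by rw [scaleFirst_comp, inv_mul_cancel₀ hw0, scaleFirst_one])
  have hσ (f) : σ f = scaleFirst n w f := rfl
  have hσpow (k : ℕ) (f) : (σ ^ k) f = scaleFirst n (w ^ k) f := by
    induction k generalizing f with
    | zero => simp [scaleFirst_one]
    | succ k ih => rw [pow_succ, AlgEquiv.mul_apply, ih, hσ, ← AlgHom.comp_apply, scaleFirst_comp,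
        pow_succ]
  have hfin : IsOfFinOrder σ := isOfFinOrder_iff_pow_eq_one.2 ⟨q, hq, by
    ext1 f
    rw [hσpow, hw.pow_eq_one, scaleFirst_one]
    rfl⟩
  -- The image `A` of the power substitution is the invariant ring of this finite cyclic group, and
  -- a finite group permutes transitively the primes over a given prime of its invariants.
  let G := Subgroup.zpowers σ
  have : Finite G := hfin.finite_zpowers
  let A := (powFirst n q).range
  have hfix : ∀ g : G, ∀ a : A, g • (a : MvPolynomial (Fin n) ℂ) = a := by
    rintro ⟨g, hg⟩ ⟨_, b, rfl⟩
    have : G ≤ MulAction.stabilizer (MvPolynomial (Fin n) ℂ ≃ₐ[ℂ] MvPolynomial (Fin n) ℂ)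
        (powFirst n q b) := Subgroup.zpowers_le.2 congr($(scaleFirst_comp_powFirst hw.pow_eq_one) b)
    exact this hg
  have : SMulCommClass G A (MvPolynomial (Fin n) ℂ) := ⟨fun g a b => by
    rw [Algebra.smul_def, Algebra.smul_def, smul_mul']
    exact congrArg (· * (g • b)) (hfix g a)⟩
  have : Algebra.IsInvariant A (MvPolynomial (Fin n) ℂ) G := ⟨fun b hb =>
    ⟨⟨b, mem_range_powFirst hw (hb ⟨σ, Subgroup.mem_zpowers σ⟩)⟩, rfl⟩⟩
  obtain ⟨⟨g, hg⟩, hgQ⟩ := Algebra.IsInvariant.exists_smul_of_under_eq A (MvPolynomial (Fin n) ℂ) G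
    P Q (by
      ext ⟨_, b, rfl⟩
      exact SetLike.ext_iff.1 hPQ b)
  obtain ⟨k, rfl⟩ := (IsOfFinOrder.mem_powers_iff_mem_zpowers hfin).2 hg
  refine ⟨k, ?_⟩
  ext f
  rw [hgQ, Ideal.mem_comap, ← hσpow]
  exact (Ideal.smul_mem_pointwise_smul_iff (a := (⟨σ ^ k, hg⟩ : G))).symm

end Substitutions

/-! ### From invariant ring elements to invariant sections over open sets. -/

/-- The section over an open subset of `Spec R` defined by an element of `R`. -/
noncomputable def specSection {R : CommRingCat.{0}} (U : (Spec R).Opens) : R ⟶ Γ(Spec R, U) :=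
  (Scheme.ΓSpecIso R).inv ≫ (Spec R).presheaf.map (homOfLE le_top).op

theorem specSection_appLE {R S : CommRingCat.{0}} (f : R ⟶ S) (V : (Spec R).Opens)
    (U : (Spec S).Opens) (e : U ≤ Spec.map f ⁻¹ᵁ V) (r : R) :
    (Spec.map f).appLE V U e (specSection V r) = specSection U (f r) := by
  have : specSection V ≫ (Spec.map f).appLE V U e = f ≫ specSection U := by
    rw [specSection, specSection, Category.assoc, Scheme.Hom.map_appLE,
      Scheme.ΓSpecIso_inv_naturality_assoc]
    rfl
  exact congr($this r)

theorem specSection_isLocalization {R : CommRingCat.{0}} (h : R) (U : (Spec R).Opens)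
    (hU : U = PrimeSpectrum.basicOpen h) :
    letI := (specSection U).hom.toAlgebra
    IsLocalization.Away h Γ(Spec R, U) := by
  subst hU
  have h1 := StructureSheaf.IsLocalization.to_basicOpen R h
  convert! h1
  refine Algebra.algebra_ext _ _ fun r => ?_
  exact congr($(Scheme.toOpen_eq (R := R) (PrimeSpectrum.basicOpen h)).hom r).symm

theorem appLE_res_eq_self {X : Scheme.{0}} (τ : X ⟶ X) {V V' : X.Opens} (i : V' ≤ V)
    (e : V ≤ τ ⁻¹ᵁ V) (e' : V' ≤ τ ⁻¹ᵁ V') (s : Γ(X, V)) (hs : τ.appLE V V e s = s) :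
    τ.appLE V' V' e' (X.presheaf.map (homOfLE i).op s) = X.presheaf.map (homOfLE i).op s := by
  conv_rhs => rw [← hs]
  rw [← CommRingCat.comp_apply, ← CommRingCat.comp_apply, Scheme.Hom.map_appLE,
    Scheme.Hom.appLE_map]

/-- If the elements of `S` fixed by `τ` come from `R`, then so do the fixed sections. -/
theorem mem_range_specMap_app {R S : CommRingCat.{0}} (f : R ⟶ S) (τ : S ⟶ S) (hτ : f ≫ τ = f)
    (hfix : ∀ b, τ b = b → ∃ a, f a = b)
    (hinj : ∀ W : (Spec R).Opens, Function.Injective ((Spec.map f).app W))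
    (W : (Spec R).Opens) (s : Γ(Spec S, Spec.map f ⁻¹ᵁ W))
    (e : Spec.map f ⁻¹ᵁ W ≤ Spec.map τ ⁻¹ᵁ (Spec.map f ⁻¹ᵁ W))
    (hs : (Spec.map τ).appLE _ _ e s = s) : s ∈ Set.range ((Spec.map f).app W) := by
  refine mem_range_app_of_local _ hinj W s fun y hy => ?_
  obtain ⟨_, ⟨_, ⟨g, rfl⟩, rfl⟩, hyg, hgW⟩ :=
    PrimeSpectrum.isBasis_basic_opens.exists_subset_of_mem_open hy W.isOpen
  obtain ⟨D, hD⟩ : ∃ D : (Spec R).Opens, D = PrimeSpectrum.basicOpen g := ⟨_, rfl⟩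
  rw [← hD] at hyg hgW
  refine ⟨D, hgW, hyg, ?_⟩
  have eD : Spec.map f ⁻¹ᵁ D ≤ Spec.map τ ⁻¹ᵁ (Spec.map f ⁻¹ᵁ D) := by
    rw [← Scheme.Hom.comp_preimage, ← Spec.map_comp, hτ]
  have htτ := appLE_res_eq_self (Spec.map τ) ((Spec.map f).preimage_mono hgW) e eD s hs
  set t := (Spec S).presheaf.map (homOfLE ((Spec.map f).preimage_mono hgW)).op s
  let := (specSection (Spec.map f ⁻¹ᵁ D)).hom.toAlgebra
  have hloc : IsLocalization.Away (f g) Γ(Spec S, Spec.map f ⁻¹ᵁ D) :=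
    specSection_isLocalization (f g) _ (hD ▸ rfl)
  have halg (b : S) : algebraMap S Γ(Spec S, Spec.map f ⁻¹ᵁ D) b =
    specSection (Spec.map f ⁻¹ᵁ D) b := rfl
  obtain ⟨k, a, hka⟩ := IsLocalization.Away.surj (f g) t
  have hfg : τ (f g) = f g := congr($hτ g)
  have h1 : algebraMap S Γ(Spec S, Spec.map f ⁻¹ᵁ D) (τ a) = algebraMap S _ a := by
    rw [halg, ← specSection_appLE τ _ _ eD, ← halg, ← hka, map_mul, htτ, map_pow, halg,
      specSection_appLE, hfg]
  -- The numerator `a` is fixed by `τ` only in the localization; a further power of `f g`, itself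
  -- fixed, makes it fixed in S.
  obtain ⟨m, hm⟩ := IsLocalization.Away.exists_of_eq (f g) h1
  obtain ⟨b, hb⟩ := hfix (f g ^ m * a) (by rw [map_mul, map_pow, hfg, hm])
  let := (specSection D).hom.toAlgebra
  have hlocD : IsLocalization.Away g Γ(Spec R, D) := specSection_isLocalization g D hD
  obtain ⟨u, hu⟩ := IsLocalization.Away.algebraMap_isUnit (S := Γ(Spec R, D)) g
  have happ (r : R) : (Spec.map f).app D (algebraMap R Γ(Spec R, D) r) =
      algebraMap S Γ(Spec S, Spec.map f ⁻¹ᵁ D) (f r) := by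
    rw [Scheme.Hom.app_eq_appLE]
    exact specSection_appLE f D _ le_rfl r
  refine ⟨algebraMap R Γ(Spec R, D) b * ((u⁻¹ : (Γ(Spec R, D))ˣ) : Γ(Spec R, D)) ^ (k + m), ?_⟩
  have hunit : IsUnit (algebraMap S Γ(Spec S, Spec.map f ⁻¹ᵁ D) (f g) ^ (k + m)) :=
    (IsLocalization.Away.algebraMap_isUnit (f g)).pow _
  refine hunit.mul_right_cancel ?_
  have h2 : t * algebraMap S Γ(Spec S, Spec.map f ⁻¹ᵁ D) (f g) ^ (k + m) =
      algebraMap S _ (f b) := by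
    rw [hb, map_mul, map_pow, pow_add, ← mul_assoc, hka, mul_comm]
  rw [h2, ← happ b, ← happ g, ← map_pow, ← map_mul, mul_assoc, ← mul_pow, ← hu, Units.inv_mul,
    one_pow, mul_one]

/-- Descent of fixed sections along `f` passes to the restriction of `f` to an open subset. -/
theorem mem_range_resLE_app {X Y : Scheme.{0}} (f : X ⟶ Y) (τ : X ⟶ X)
    (h : ∀ (W : Y.Opens) (s : Γ(X, f ⁻¹ᵁ W)) (e : f ⁻¹ᵁ W ≤ τ ⁻¹ᵁ (f ⁻¹ᵁ W)),
      τ.appLE _ _ e s = s → s ∈ Set.range (f.app W))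
    (U : Y.Opens) (V : X.Opens) (hV : V = f ⁻¹ᵁ U) (hτV : V ≤ τ ⁻¹ᵁ V)
    (W : U.toScheme.Opens) (s : Γ(V, f.resLE U V hV.le ⁻¹ᵁ W))
    (e : f.resLE U V hV.le ⁻¹ᵁ W ≤ τ.resLE V V hτV ⁻¹ᵁ (f.resLE U V hV.le ⁻¹ᵁ W))
    (hs : (τ.resLE V V hτV).appLE _ _ e s = s) :
    s ∈ Set.range ((f.resLE U V hV.le).app W) := by
  have hW : f ⁻¹ᵁ (U.ι ''ᵁ W) = V.ι ''ᵁ (f.resLE U V hV.le ⁻¹ᵁ W) := by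
    rw [Scheme.Hom.resLE_preimage, Scheme.Hom.image_preimage_eq_opensRange_inf,
      Scheme.Opens.opensRange_ι, hV, ← Scheme.Hom.preimage_inf, inf_eq_right.2 (U.ι_image_le W)]
  rw [Scheme.Hom.resLE_appLE] at hs
  have e' := (Scheme.Hom.le_resLE_preimage_iff τ hτV _ _).1 e
  -- The open set is generalized so that the equality `hW`, which is not definitional, can be
  -- substituted away.
  have key : ∀ (O : X.Opens) (hO : f ⁻¹ᵁ (U.ι ''ᵁ W) = O) (e : O ≤ τ ⁻¹ᵁ O) (s : Γ(X, O)),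
      τ.appLE O O e s = s → ∃ a, f.appLE (U.ι ''ᵁ W) O hO.ge a = s := by
    rintro _ rfl e s hs
    obtain ⟨a, ha⟩ := h _ s e hs
    exact ⟨a, by rwa [Scheme.Hom.appLE_eq_app]⟩
  obtain ⟨a, ha⟩ := key _ hW e' s hs
  exact ⟨a, by rw [Scheme.Hom.app_eq_appLE, Scheme.Hom.resLE_appLE]; exact ha⟩

/-! ### The power map and scalings on ℂⁿ - V(I). -/

/-- An endomorphism of `ℂ[x₁, …, xₙ]` that preserves the vanishing loci of the variables
preserves the vanishing loci of the monomials. -/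
theorem map_monomial_mem_iff {n : ℕ} (α : MvPolynomial (Fin n) ℂ →ₐ[ℂ] MvPolynomial (Fin n) ℂ)
    (P : Ideal (MvPolynomial (Fin n) ℂ)) [hP : P.IsPrime]
    (hα : ∀ j : Fin n, α (MvPolynomial.X j) ∈ P ↔ MvPolynomial.X j ∈ P) (s : Fin n →₀ ℕ) :
    α (MvPolynomial.monomial s 1) ∈ P ↔ MvPolynomial.monomial s 1 ∈ P := by
  rw [MvPolynomial.monomial_eq, map_one, one_mul, Finsupp.prod, map_prod,
    hP.prod_mem_iff, hP.prod_mem_iff]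
  refine exists_congr fun j => and_congr_right fun hj => ?_
  have hj0 : 0 < s j := Nat.pos_of_ne_zero (Finsupp.mem_support_iff.1 hj)
  rw [map_pow, hP.pow_mem_iff_mem _ hj0, hP.pow_mem_iff_mem _ hj0, hα]

theorem mem_coxOpens {n : ℕ} {I : Ideal (MvPolynomial (Fin n) ℂ)} {z : affineSpaceC n} :
    z ∈ coxOpens I ↔ ¬ I ≤ PrimeSpectrum.asIdeal z := Iff.rfl

/-- Whether a prime contains a monomial depends only on which variables it contains, and I is
generated by monomials. -/
theorem preimage_coxOpens {n : ℕ} {I : Ideal (MvPolynomial (Fin n) ℂ)} (hI : IsMonomialIdeal I)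
    (α : MvPolynomial (Fin n) ℂ →ₐ[ℂ] MvPolynomial (Fin n) ℂ)
    (hα : ∀ (P : Ideal (MvPolynomial (Fin n) ℂ)) [P.IsPrime] (j : Fin n),
      α (MvPolynomial.X j) ∈ P ↔ MvPolynomial.X j ∈ P) :
    coxOpens I = Spec.map (CommRingCat.ofHom α.toRingHom) ⁻¹ᵁ coxOpens I := by
  obtain ⟨S, rfl⟩ := hI
  ext z
  have hz : (PrimeSpectrum.asIdeal z).IsPrime := PrimeSpectrum.isPrime z
  change z ∈ coxOpens _ ↔ Spec.map (CommRingCat.ofHom α.toRingHom) z ∈ coxOpens _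
  rw [mem_coxOpens, mem_coxOpens, not_iff_not, Ideal.span_le, Ideal.span_le,
    Set.image_subset_iff, Set.image_subset_iff]
  exact forall₂_congr fun s _ => (map_monomial_mem_iff α _ (hα _) s).symm

/-- The endomorphism of `ℂⁿ` given by `x₁ ↦ x₁ ^ q`. -/
noncomputable abbrev affinePow (n : ℕ) [NeZero n] (q : ℕ) : affineSpaceC n ⟶ affineSpaceC n :=
  Spec.map (CommRingCat.ofHom (powFirst n q).toRingHom)

/-- The endomorphism of `ℂⁿ` given by `x₁ ↦ w x₁`. -/
noncomputable abbrev affineScale (n : ℕ) [NeZero n] (w : ℂ) : affineSpaceC n ⟶ affineSpaceC n :=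
  Spec.map (CommRingCat.ofHom (scaleFirst n w).toRingHom)

section CoxSpace

variable {n : ℕ} [NeZero n] {I : Ideal (MvPolynomial (Fin n) ℂ)}

theorem affinePow_preimage (hI : IsMonomialIdeal I) {q : ℕ} (hq : 0 < q) :
    coxOpens I = affinePow n q ⁻¹ᵁ coxOpens I := by
  refine preimage_coxOpens hI _ fun P hP j => ?_
  rcases eq_or_ne j 0 with rfl | hj
  · simpa using hP.pow_mem_iff_mem q hq
  · simp [hj]

theorem affineScale_preimage (hI : IsMonomialIdeal I) {w : ℂ} (hw : w ≠ 0) :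
    coxOpens I = affineScale n w ⁻¹ᵁ coxOpens I := by
  refine preimage_coxOpens hI _ fun P hP j => ?_
  rcases eq_or_ne j 0 with rfl | hj
  · rw [scaleFirst_X, if_pos rfl]
    exact P.unit_mul_mem_iff_mem ((Ne.isUnit hw).map MvPolynomial.C)
  · simp [hj]

/-- The endomorphism of `ℂⁿ - V(I)` given by `x₁ ↦ x₁ ^ q`. -/
noncomputable def coxPow (hI : IsMonomialIdeal I) {q : ℕ} (hq : 0 < q) :
    coxSpace I ⟶ coxSpace I :=
  (affinePow n q).resLE (coxOpens I) (coxOpens I) (affinePow_preimage hI hq).le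

/-- The endomorphism of `ℂⁿ - V(I)` given by `x₁ ↦ w x₁`. -/
noncomputable def coxScale (hI : IsMonomialIdeal I) {w : ℂ} (hw : w ≠ 0) :
    coxSpace I ⟶ coxSpace I :=
  (affineScale n w).resLE (coxOpens I) (coxOpens I) (affineScale_preimage hI hw).le

theorem coxPow_ι (hI : IsMonomialIdeal I) {q : ℕ} (hq : 0 < q) :
    coxPow hI hq ≫ (coxOpens I).ι = (coxOpens I).ι ≫ affinePow n q :=
  Scheme.Hom.resLE_comp_ι _ _

theorem coxScale_ι (hI : IsMonomialIdeal I) {w : ℂ} (hw : w ≠ 0) :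
    coxScale hI hw ≫ (coxOpens I).ι = (coxOpens I).ι ≫ affineScale n w :=
  Scheme.Hom.resLE_comp_ι _ _

theorem affinePow_isIntegralHom {q : ℕ} (hq : 0 < q) : IsIntegralHom (affinePow n q) :=
  IsIntegralHom.SpecMap_iff.2 (powFirst_isIntegral hq)

theorem affinePow_surjective {q : ℕ} (hq : 0 < q) : Surjective (affinePow n q) :=
  ⟨(powFirst_isIntegral hq).comap_surjective (powFirst_injective hq)⟩

theorem coxPow_isIntegralHom (hI : IsMonomialIdeal I) {q : ℕ} (hq : 0 < q) :
    IsIntegralHom (coxPow hI hq) := by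
  have := affinePow_isIntegralHom (n := n) hq
  refine (Scheme.Hom.resLE_congr _ _ rfl (affinePow_preimage hI hq) @IsIntegralHom).2 ?_
  rw [Scheme.Hom.resLE_eq_morphismRestrict]
  infer_instance

theorem coxPow_surjective (hI : IsMonomialIdeal I) {q : ℕ} (hq : 0 < q) :
    Surjective (coxPow hI hq) := by
  have := affinePow_surjective (n := n) hq
  refine (Scheme.Hom.resLE_congr _ _ rfl (affinePow_preimage hI hq) @Surjective).2 ?_
  rw [Scheme.Hom.resLE_eq_morphismRestrict]
  exact MorphismProperty.of_isPullback (P := @Surjective)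
    (isPullback_morphismRestrict (affinePow n q) (coxOpens I)).flip ‹_›

/-- A quasi-compact surjective morphism to a reduced scheme is injective on sections. -/
theorem app_injective_of_surjective {X Y : Scheme.{0}} (f : X ⟶ Y) [Surjective f] [QuasiCompact f]
    [IsReduced Y] (W : Y.Opens) : Function.Injective (f.app W) := by
  have : IsSchemeTheoreticallyDominant f := .of_isDominant f
  exact f.app_injective W

theorem coxPow_app_injective (hI : IsMonomialIdeal I) {q : ℕ} (hq : 0 < q)
    (W : (coxSpace I).Opens) : Function.Injective ((coxPow hI hq).app W) := by
  have := coxPow_isIntegralHom hI hq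
  have := coxPow_surjective hI hq
  exact app_injective_of_surjective _ W

/-- The map `x₁ ↦ x₁ ^ q` identifies functions on the target with functions on the source that are
invariant under scaling `x₁` by `q`-th roots of unity. -/
theorem mem_range_coxPow_app (hI : IsMonomialIdeal I) {q : ℕ} (hq : 0 < q) {w : ℂ}
    (hw : IsPrimitiveRoot w q) (W : (coxSpace I).Opens) (s : Γ(coxSpace I, coxPow hI hq ⁻¹ᵁ W))
    (e : coxPow hI hq ⁻¹ᵁ W ≤ coxScale hI (hw.ne_zero hq.ne') ⁻¹ᵁ (coxPow hI hq ⁻¹ᵁ W))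
    (hs : (coxScale hI (hw.ne_zero hq.ne')).appLE _ _ e s = s) :
    s ∈ Set.range ((coxPow hI hq).app W) := by
  have := affinePow_isIntegralHom (n := n) hq
  have := affinePow_surjective (n := n) hq
  refine mem_range_resLE_app (affinePow n q) (affineScale n w) (fun W s e hs => ?_) (coxOpens I)
    (coxOpens I) (affinePow_preimage hI hq) (affineScale_preimage hI (hw.ne_zero hq.ne')).le W s e hs
  refine mem_range_specMap_app _ _ ?_ (fun b hb => mem_range_powFirst hw hb)
    (app_injective_of_surjective _) W s e hs
  rw [← CommRingCat.ofHom_comp]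
  exact congr(CommRingCat.ofHom ($(scaleFirst_comp_powFirst hw.pow_eq_one)).toRingHom)

theorem affineScale_comp_affineScale (v w : ℂ) :
    affineScale n v ≫ affineScale n w = affineScale n (v * w) := by
  rw [← Spec.map_comp, ← CommRingCat.ofHom_comp]
  exact congr(Spec.map (CommRingCat.ofHom ($(scaleFirst_comp v w)).toRingHom))

theorem coxScale_comp_coxPow (hI : IsMonomialIdeal I) {q : ℕ} (hq : 0 < q) {w : ℂ} (hw0 : w ≠ 0)
    (hw : w ^ q = 1) : coxScale hI hw0 ≫ coxPow hI hq = coxPow hI hq := by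
  rw [← cancel_mono (coxOpens I).ι, Category.assoc, coxPow_ι, reassoc_of% (coxScale_ι hI hw0),
    ← Spec.map_comp, ← CommRingCat.ofHom_comp]
  exact congr((coxOpens I).ι ≫
    Spec.map (CommRingCat.ofHom ($(scaleFirst_comp_powFirst hw)).toRingHom))

/-- Points of `ℂⁿ - V(I)` with the same image under `x₁ ↦ x₁ ^ q` differ by a scaling of `x₁` by a
`q`-th root of unity. -/
theorem exists_coxScale_iterate_eq (hI : IsMonomialIdeal I) {q : ℕ} (hq : 0 < q) {w : ℂ}
    (hw : IsPrimitiveRoot w q) (u v : coxSpace I) (huv : coxPow hI hq u = coxPow hI hq v) :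
    ∃ k : ℕ, (coxScale hI (hw.ne_zero hq.ne'))^[k] v = u := by
  have hι (x : coxSpace I) : (coxOpens I).ι (coxPow hI hq x) = affinePow n q ((coxOpens I).ι x) :=
    congr($(coxPow_ι hI hq) x)
  have hσ : Function.Semiconj (coxOpens I).ι (coxScale hI (hw.ne_zero hq.ne'))
      (affineScale n w) := fun x => congr($(coxScale_ι hI (hw.ne_zero hq.ne')) x)
  have hcomap : affinePow n q ((coxOpens I).ι u) = affinePow n q ((coxOpens I).ι v) := by
    rw [← hι, ← hι, huv]
  have := PrimeSpectrum.isPrime ((coxOpens I).ι u)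
  have := PrimeSpectrum.isPrime ((coxOpens I).ι v)
  obtain ⟨k, hk⟩ := exists_comap_scaleFirst_eq hq hw (PrimeSpectrum.asIdeal ((coxOpens I).ι u))
    (PrimeSpectrum.asIdeal ((coxOpens I).ι v)) congr(PrimeSpectrum.asIdeal $hcomap)
  have hpow (m : ℕ) (x : affineSpaceC n) : (affineScale n w)^[m] x = affineScale n (w ^ m) x := by
    induction m with
    | zero =>
      have : affineScale n 1 = 𝟙 _ := by
        rw [← Spec.map_id]
        exact congr(Spec.map (CommRingCat.ofHom ($(scaleFirst_one)).toRingHom))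
      rw [pow_zero, this]
      rfl
    | succ m ih =>
      rw [Function.iterate_succ_apply', ih, pow_succ, ← affineScale_comp_affineScale]
      rfl
  refine ⟨k, (coxOpens I).ι.isOpenEmbedding.injective ?_⟩
  rw [(hσ.iterate_right k).eq, hpow]
  exact PrimeSpectrum.ext hk.symm

/-- A morphism invariant under scaling `x₁` by `q`-th roots of unity factors through
`x₁ ↦ x₁ ^ q`. -/
theorem exists_desc_coxPow (hI : IsMonomialIdeal I) {q : ℕ} (hq : 0 < q) {w : ℂ}
    (hw : IsPrimitiveRoot w q) {Z : Scheme.{0}} (ψ : coxSpace I ⟶ Z)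
    (hψ : coxScale hI (hw.ne_zero hq.ne') ≫ ψ = ψ) : ∃ χ, coxPow hI hq ≫ χ = ψ := by
  have := coxPow_isIntegralHom hI hq
  have hsurj := coxPow_surjective hI hq
  refine exists_desc _ ψ ?_ (coxPow_app_injective hI hq) ?_ ?_
  · exact (Scheme.Hom.isClosedMap _).isQuotientMap (Scheme.Hom.continuous _) hsurj.surj
  · intro u v huv
    -- One primitive root generates all the scalings, so invariance under it alone is iterated along
    -- the fibre.
    obtain ⟨k, rfl⟩ := exists_coxScale_iterate_eq hI hq hw u v huv
    clear huv
    induction k with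
    | zero => rfl
    | succ k ih =>
      rw [Function.iterate_succ_apply', ← ih]
      exact congr($hψ _)
  · intro W V e s
    have e' : coxPow hI hq ⁻¹ᵁ W ≤ coxScale hI (hw.ne_zero hq.ne') ⁻¹ᵁ (coxPow hI hq ⁻¹ᵁ W) := by
      rw [← Scheme.Hom.comp_preimage, coxScale_comp_coxPow hI hq _ hw.pow_eq_one]
    refine mem_range_coxPow_app hI hq hw W _ e' ?_
    rw [← CommRingCat.comp_apply, Scheme.Hom.appLE_comp_appLE, appLE_congr_hom hψ]

end CoxSpace

/-! ### Roots of unity inside the torus. -/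

/-- Evaluation of Laurent polynomials at the point `(z, 1, …, 1)` of the torus. -/
noncomputable def evalFirst (r : ℕ) [NeZero r] (z : ℂˣ) : LaurentRing r →ₐ[ℂ] ℂ :=
  AddMonoidAlgebra.lift ℂ ℂ (Fin r → ℤ)
    { toFun := fun m => ((z ^ (m.toAdd 0) : ℂˣ) : ℂ)
      map_one' := by simp
      map_mul' := fun m m' => by simp [zpow_add] }

theorem evalFirst_laurentMonomial {r : ℕ} [NeZero r] (z : ℂˣ) (m : Fin r → ℤ) :
    evalFirst r z (laurentMonomial m) = ((z ^ m 0 : ℂˣ) : ℂ) := by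
  simp [evalFirst, laurentMonomial]

/-- The section of `G × U ⟶ U` defined by the point of `G` with coaction `ev`. -/
noncomputable def torusPoint {r n : ℕ} (ev : LaurentRing r →ₐ[ℂ] ℂ)
    (I : Ideal (MvPolynomial (Fin n) ℂ)) : coxSpace I ⟶ pullback (torusStr r) (coxStr I) :=
  pullback.lift (coxStr I ≫ Spec.map (CommRingCat.ofHom ev.toRingHom)) (𝟙 _) (by
    rw [Category.assoc, ← Spec.map_comp, ← CommRingCat.ofHom_comp, Category.id_comp]
    have : ev.toRingHom.comp (algebraMap ℂ (LaurentRing r)) = RingHom.id ℂ := by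
      ext; simp
    rw [this]
    exact (congrArg (coxStr I ≫ ·) (Spec.map_id _)).trans (Category.comp_id _))

/-- In coordinates the section is dual to p ⊗ f ↦ ev(p) f, which reduces the action of a torus point
to composing this map with the coaction. -/
theorem torusPoint_torusProdIncl {r n : ℕ} (ev : LaurentRing r →ₐ[ℂ] ℂ)
    (I : Ideal (MvPolynomial (Fin n) ℂ)) :
    torusPoint ev I ≫ torusProdIncl r I = (coxOpens I).ι ≫
      Spec.map (CommRingCat.ofHom (Algebra.TensorProduct.productMap
        ((Algebra.ofId ℂ (MvPolynomial (Fin n) ℂ)).comp ev)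
        (AlgHom.id ℂ (MvPolynomial (Fin n) ℂ))).toRingHom) ≫
      (pullbackSpecIso ℂ (LaurentRing r) (MvPolynomial (Fin n) ℂ)).inv := by
  apply pullback.hom_ext
  · simp only [torusPoint, torusProdIncl, Category.assoc, pullback.lift_fst, pullback.map,
      Category.comp_id]
    erw [pullbackSpecIso_inv_fst]
    rw [← Spec.map_comp, ← Spec.map_comp, ← CommRingCat.ofHom_comp, ← CommRingCat.ofHom_comp]
    congr 3
    ext x <;> simp
  · simp only [torusPoint, torusProdIncl, Category.assoc, pullback.lift_snd, pullback.map,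
      pullback.lift_snd_assoc, Category.id_comp]
    erw [pullbackSpecIso_inv_snd]
    rw [← Spec.map_comp, ← CommRingCat.ofHom_comp]
    have : ((Algebra.TensorProduct.productMap
        ((Algebra.ofId ℂ (MvPolynomial (Fin n) ℂ)).comp ev)
        (AlgHom.id ℂ (MvPolynomial (Fin n) ℂ))).toRingHom.comp
          (Algebra.TensorProduct.includeRight.toRingHom)) = RingHom.id _ := by
      ext x <;> simp
    erw [this]
    exact ((congrArg ((coxOpens I).ι ≫ ·) (Spec.map_id _)).trans (Category.comp_id _)).symm

theorem coxAction_ι {r n : ℕ} (A : Matrix (Fin r) (Fin n) ℤ)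
    {I : Ideal (MvPolynomial (Fin n) ℂ)} (hI : IsMonomialIdeal I) :
    coxAction A hI ≫ (coxOpens I).ι = torusProdIncl r I ≫ affineAction A :=
  IsOpenImmersion.lift_fac _ _ _

section Torus

variable {r n : ℕ} [NeZero r] [NeZero n] {I : Ideal (MvPolynomial (Fin n) ℂ)}

/-- If `z` is a `q`-th root of unity and `q` divides all entries but the first of the first row of
`A`, then `(z, 1, …, 1)` acts by scaling `x₁`. -/
theorem torusPoint_coxAction (hI : IsMonomialIdeal I) (A : Matrix (Fin r) (Fin n) ℤ) {q : ℕ}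
    (hdvd : ∀ j : Fin n, j ≠ 0 → (q : ℤ) ∣ A 0 j) (z : ℂˣ) (hz : z ^ q = 1) :
    torusPoint (evalFirst r z) I ≫ coxAction A hI = coxScale hI (z ^ A 0 0).ne_zero := by
  rw [← cancel_mono (coxOpens I).ι, Category.assoc, coxAction_ι,
    reassoc_of% (torusPoint_torusProdIncl (evalFirst r z) I), coxScale_ι]
  rw [affineAction, Iso.inv_hom_id_assoc, ← Spec.map_comp, ← CommRingCat.ofHom_comp]
  congr 3
  have h : (Algebra.TensorProduct.productMap
        ((Algebra.ofId ℂ (MvPolynomial (Fin n) ℂ)).comp (evalFirst r z))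
        (AlgHom.id ℂ (MvPolynomial (Fin n) ℂ))).comp (coaction A) =
      scaleFirst n ((z ^ A 0 0 : ℂˣ) : ℂ) := by
    refine MvPolynomial.algHom_ext fun j => ?_
    rw [AlgHom.comp_apply, coaction, MvPolynomial.aeval_X,
      Algebra.TensorProduct.productMap_apply_tmul, AlgHom.comp_apply, evalFirst_laurentMonomial,
      scaleFirst_X]
    split_ifs with hj
    · subst hj
      rfl
    -- The weight of x_j is a multiple of q in the first torus coordinate, so z acts trivially.
    · obtain ⟨k, hk⟩ := hdvd j hj
      simp [hk, zpow_mul, hz]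
  exact congr(($h).toRingHom)

theorem coxScale_comp_of_invariant (hI : IsMonomialIdeal I) (A : Matrix (Fin r) (Fin n) ℤ) {q : ℕ}
    (hdvd : ∀ j : Fin n, j ≠ 0 → (q : ℤ) ∣ A 0 j) (z : ℂˣ) (hz : z ^ q = 1) {X : Scheme.{0}}
    (π : coxSpace I ⟶ X)
    (hπ : coxAction A hI ≫ π = pullback.snd (torusStr r) (coxStr I) ≫ π) :
    coxScale hI (z ^ A 0 0).ne_zero ≫ π = π := by
  rw [← torusPoint_coxAction hI A hdvd z hz, Category.assoc, hπ, torusPoint,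
    pullback.lift_snd_assoc, Category.id_comp]

end Torus

/-! ### Equivariance of the power map. -/

theorem torusProd_isReduced (r : ℕ) {n : ℕ} (I : Ideal (MvPolynomial (Fin n) ℂ)) : IsReduced (pullback (torusStr r) (coxStr I)) := by
  have h1 : IsOpenImmersion (torusProdIncl r I) :=
    MorphismProperty.pullbackMap (P := @IsOpenImmersion) (inferInstance : IsOpenImmersion (𝟙 _))
      (inferInstance : IsOpenImmersion (coxOpens I).ι) (by simp) (by simp)
  have h2 : _root_.IsReduced (LaurentRing r ⊗[ℂ] MvPolynomial (Fin n) ℂ) :=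
    isReduced_of_injective _ (MvPolynomial.algebraTensorAlgEquiv ℂ (LaurentRing r)).injective
  have h3 : IsReduced (Spec (CommRingCat.of (LaurentRing r ⊗[ℂ] MvPolynomial (Fin n) ℂ))) :=
    inferInstance
  exact isReduced_of_isOpenImmersion (torusProdIncl r I ≫
    (pullbackSpecIso ℂ (LaurentRing r) (MvPolynomial (Fin n) ℂ)).hom)

section Equivariance

variable {n : ℕ} [NeZero n] {I : Ideal (MvPolynomial (Fin n) ℂ)}

theorem affinePow_affineStr (q : ℕ) : affinePow n q ≫ affineStr n = affineStr n := by
  rw [← Spec.map_comp, ← CommRingCat.ofHom_comp]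
  exact congr(Spec.map (CommRingCat.ofHom $((powFirst n q).comp_algebraMap)))

theorem coxPow_coxStr (hI : IsMonomialIdeal I) {q : ℕ} (hq : 0 < q) :
    coxPow hI hq ≫ coxStr I = coxStr I := by
  rw [reassoc_of% (coxPow_ι hI hq), affinePow_affineStr]

/-- The endomorphism of `G × (ℂⁿ - V(I))` given by `x₁ ↦ x₁ ^ q`. -/
noncomputable def torusProdPow (r : ℕ) (hI : IsMonomialIdeal I) {q : ℕ} (hq : 0 < q) :
    pullback (torusStr r) (coxStr I) ⟶ pullback (torusStr r) (coxStr I) :=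
  pullback.map _ _ _ _ (𝟙 _) (coxPow hI hq) (𝟙 _) (by simp)
    (by rw [Category.comp_id, coxPow_coxStr])

theorem torusProdPow_snd (r : ℕ) (hI : IsMonomialIdeal I) {q : ℕ} (hq : 0 < q) :
    torusProdPow r hI hq ≫ pullback.snd (torusStr r) (coxStr I) =
      pullback.snd (torusStr r) (coxStr I) ≫ coxPow hI hq :=
  pullback.lift_snd _ _ _

theorem tensorPow_fst (r q : ℕ) :
    Spec.map (CommRingCat.ofHom (Algebra.TensorProduct.map (AlgHom.id ℂ (LaurentRing r))
      (powFirst n q)).toRingHom) ≫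
      (pullbackSpecIso ℂ (LaurentRing r) (MvPolynomial (Fin n) ℂ)).inv ≫
        pullback.fst (torusStr r) (affineStr n) =
      (pullbackSpecIso ℂ (LaurentRing r) (MvPolynomial (Fin n) ℂ)).inv ≫
        pullback.fst (torusStr r) (affineStr n) := by
  have h : (Algebra.TensorProduct.map (AlgHom.id ℂ (LaurentRing r))
      (powFirst n q)).toRingHom.comp Algebra.TensorProduct.includeLeftRingHom =
      Algebra.TensorProduct.includeLeftRingHom := by
    ext x <;> simp
  rw [pullbackSpecIso_inv_fst, ← Spec.map_comp, ← CommRingCat.ofHom_comp]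
  exact congr(Spec.map (CommRingCat.ofHom $h))

theorem tensorPow_snd (r q : ℕ) :
    Spec.map (CommRingCat.ofHom (Algebra.TensorProduct.map (AlgHom.id ℂ (LaurentRing r))
      (powFirst n q)).toRingHom) ≫
      (pullbackSpecIso ℂ (LaurentRing r) (MvPolynomial (Fin n) ℂ)).inv ≫
        pullback.snd (torusStr r) (affineStr n) =
      (pullbackSpecIso ℂ (LaurentRing r) (MvPolynomial (Fin n) ℂ)).inv ≫
        pullback.snd (torusStr r) (affineStr n) ≫ affinePow n q := by
  have h : (Algebra.TensorProduct.map (AlgHom.id ℂ (LaurentRing r))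
      (powFirst n q)).toRingHom.comp
        (RingHomClass.toRingHom Algebra.TensorProduct.includeRight) =
      (RingHomClass.toRingHom Algebra.TensorProduct.includeRight).comp
        (powFirst n q).toRingHom := by
    ext x <;> simp
  rw [pullbackSpecIso_inv_snd_assoc, pullbackSpecIso_inv_snd, ← Spec.map_comp, ← Spec.map_comp,
    ← CommRingCat.ofHom_comp, ← CommRingCat.ofHom_comp]
  exact congr(Spec.map (CommRingCat.ofHom $h))

theorem torusProdPow_torusProdIncl (r : ℕ) (hI : IsMonomialIdeal I) {q : ℕ} (hq : 0 < q) :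
    torusProdPow r hI hq ≫ torusProdIncl r I = torusProdIncl r I ≫
      (pullbackSpecIso ℂ (LaurentRing r) (MvPolynomial (Fin n) ℂ)).hom ≫
      Spec.map (CommRingCat.ofHom (Algebra.TensorProduct.map (AlgHom.id ℂ (LaurentRing r))
        (powFirst n q)).toRingHom) ≫
      (pullbackSpecIso ℂ (LaurentRing r) (MvPolynomial (Fin n) ℂ)).inv := by
  apply pullback.hom_ext
  · rw [Category.assoc, Category.assoc, Category.assoc, Category.assoc, tensorPow_fst,
      Iso.hom_inv_id_assoc]
    simp only [torusProdPow, torusProdIncl, pullback.lift_fst, pullback.map, Category.comp_id]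
  · rw [Category.assoc, Category.assoc, Category.assoc, Category.assoc, tensorPow_snd,
      Iso.hom_inv_id_assoc]
    simp only [torusProdPow, torusProdIncl, pullback.lift_snd, pullback.map,
      pullback.lift_snd_assoc, Category.assoc, coxPow_ι]

/-- Raising to the q-th power multiplies the weight of x₁ by q; this is what dictates the matrix B.
The check takes place on the coactions, variable by variable. -/
theorem torusProdPow_coxAction {r : ℕ} (hI : IsMonomialIdeal I) (A : Matrix (Fin r) (Fin n) ℤ)
    {q : ℕ} (hq : 0 < q) :
    torusProdPow r hI hq ≫ coxAction (mulFirstCol A q) hI = coxAction A hI ≫ coxPow hI hq := by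
  rw [← cancel_mono (coxOpens I).ι, Category.assoc, Category.assoc, coxAction_ι, coxPow_ι,
    reassoc_of% (coxAction_ι A hI), reassoc_of% (torusProdPow_torusProdIncl r hI hq),
    affineAction, affineAction, Iso.inv_hom_id_assoc, Category.assoc, ← Spec.map_comp,
    ← Spec.map_comp, ← CommRingCat.ofHom_comp, ← CommRingCat.ofHom_comp]
  have h : (Algebra.TensorProduct.map (AlgHom.id ℂ (LaurentRing r)) (powFirst n q)).comp
      (coaction (mulFirstCol A q)) = (coaction A).comp (powFirst n q) := by
    refine MvPolynomial.algHom_ext fun j => ?_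
    rw [AlgHom.comp_apply, AlgHom.comp_apply, powFirst_X, coaction, MvPolynomial.aeval_X,
      Algebra.TensorProduct.map_tmul, powFirst_X]
    split_ifs with hj
    · subst hj
      have : laurentMonomial (fun i => mulFirstCol A q i 0) =
          laurentMonomial (fun i => A i 0) ^ q := by
        rw [laurentMonomial, laurentMonomial, AddMonoidAlgebra.single_pow, one_pow]
        congr 1
      rw [this, map_pow (coaction A), coaction, MvPolynomial.aeval_X,
        Algebra.TensorProduct.tmul_pow]
      rfl
    · simp [coaction, mulFirstCol, hj]
  exact congr(torusProdIncl r I ≫ (pullbackSpecIso ℂ (LaurentRing r) (MvPolynomial (Fin n) ℂ)).hom ≫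
    Spec.map (CommRingCat.ofHom ($h).toRingHom))

/-- Allows invariance under G_B to be tested after pullback to the G_A side. A quasi-compact
surjection onto a reduced scheme is injective on sections, hence epi. -/
theorem torusProdPow_epi (r : ℕ) (hI : IsMonomialIdeal I) {q : ℕ} (hq : 0 < q) :
    Epi (torusProdPow r hI hq) := by
  have := torusProd_isReduced r I
  have := coxPow_isIntegralHom hI hq
  have := coxPow_surjective hI hq
  have h1 : QuasiCompact (torusProdPow r hI hq) :=
    MorphismProperty.pullbackMap (P := @QuasiCompact) (inferInstance : QuasiCompact (𝟙 _))
      (inferInstance : QuasiCompact (coxPow hI hq)) (by simp) (coxPow_coxStr hI hq).symm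
  have h2 : Surjective (torusProdPow r hI hq) := ⟨fun p => by
    have : p ∈ Set.range (torusProdPow r hI hq) := by
      rw [torusProdPow, Scheme.Pullback.range_map]
      exact ⟨⟨_, rfl⟩, (coxPow_surjective hI hq).surj _⟩
    exact this⟩
  exact epi_of_surjective_of_app_injective _ h2.surj (app_injective_of_surjective _)

end Equivariance

/-! ### The main theorem. -/

theorem lemma2p5 {r n : ℕ} [NeZero r] [NeZero n]
    (I : Ideal (MvPolynomial (Fin n) ℂ)) (hI : IsMonomialIdeal I)
    (A : Matrix (Fin r) (Fin n) ℤ) (q : ℕ) (hq0 : 0 < q) (hq1 : q ≠ 1)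
    (hdvd : ∀ j : Fin n, j ≠ 0 → (q : ℤ) ∣ A 0 j) (hndvd : ¬ (q : ℤ) ∣ A 0 0)
    (hA : Function.Surjective A.mulVec ∨ IsCoprime (q : ℤ) (A 0 0))
    (X : Scheme.{0}) (x : X ⟶ SpecC) (π : coxSpace I ⟶ X) (hπ : IsCoxQuotient A hI x π) :
    (∃ (Y : Scheme.{0}) (y : Y ⟶ SpecC) (ρ : coxSpace I ⟶ Y),
        IsCoxQuotient (mulFirstCol A q) hI y ρ) ∧
      ∀ (Y : Scheme.{0}) (y : Y ⟶ SpecC) (ρ : coxSpace I ⟶ Y),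
        IsCoxQuotient (mulFirstCol A q) hI y ρ → ∃ e : Y ≅ X, e.hom ≫ x = y := by
  have hcop : IsCoprime (q : ℤ) (A 0 0) := by
    refine hA.elim (fun hsurj => ?_) id
    -- The first row takes the value 1 on some integer vector `v`; modulo q only the term a₁₁ v₁
    -- survives, so a₁₁ is a unit modulo q.
    obtain ⟨v, hv⟩ := hsurj (Pi.single 0 1)
    have h0 := congrFun hv 0
    rw [Matrix.mulVec, dotProduct, Pi.single_eq_same,
      ← Finset.add_sum_erase _ _ (Finset.mem_univ (0 : Fin n))] at h0
    obtain ⟨c, hc⟩ : (q : ℤ) ∣ ∑ j ∈ Finset.univ.erase 0, A 0 j * v j :=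
      Finset.dvd_sum fun j hj => (hdvd j (Finset.ne_of_mem_erase hj)).mul_right _
    exact ⟨c, v 0, by rw [← h0, hc]; ring⟩
  have : NeZero q := ⟨hq0.ne'⟩
  obtain ⟨z, hz⟩ : ∃ z : ℂˣ, IsPrimitiveRoot z q := by
    have := Complex.isPrimitiveRoot_exp q hq0.ne'
    exact ⟨(this.isUnit hq0.ne').unit, this.isUnit_unit hq0.ne'⟩
  -- This is where coprimality enters: without it, the torus points (z, 1, …, 1) would give only a
  -- proper subgroup of the q-th roots of unity scaling x₁.
  have hw : IsPrimitiveRoot ((z ^ A 0 0 : ℂˣ) : ℂ) q := by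
    rw [IsPrimitiveRoot.coe_units_iff]
    exact hz.zpow_of_gcd_eq_one _ (by rw [Int.gcd_comm]; exact Int.isCoprime_iff_gcd_eq_one.1 hcop)
  obtain ⟨ρ, hρ⟩ := exists_desc_coxPow hI hq0 hw π
    (coxScale_comp_of_invariant hI A hdvd z hz.pow_eq_one π hπ.2.invariant)
  have hρ' : IsGeometricQuotient (coxAction (mulFirstCol A q) hI)
      (pullback.snd (torusStr r) (coxStr I)) ρ :=
    IsGeometricQuotient.of_comp (hρ ▸ hπ.2) (torusProdPow_coxAction hI A hq0)
      (torusProdPow_snd r hI hq0) (coxPow_surjective hI hq0).surj (torusProdPow_epi r hI hq0)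
      (coxPow_app_injective hI hq0)
  have hρx : ρ ≫ x = coxStr I := by
    have : Epi (coxPow hI hq0) := epi_of_surjective_of_app_injective _
      (coxPow_surjective hI hq0).surj (coxPow_app_injective hI hq0)
    rw [← cancel_epi (coxPow hI hq0), reassoc_of% hρ, hπ.1, coxPow_coxStr]
  refine ⟨⟨X, x, ρ, hρx, hρ'⟩, fun Y y τ hτ => ?_⟩
  obtain ⟨e, he⟩ := exists_iso_of_isGeometricQuotient hρ' hτ.2
  have := epi_of_isGeometricQuotient hτ.2
  exact ⟨e, by rw [← cancel_epi τ, reassoc_of% he, hρx, hτ.1]⟩
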